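/- Let $n$ and $r$ be positive integers and let $x=(x_1,\dots,x_n)$ be indeterminates; all expressions below are rational functions in $x_1^{1/2},\dots,x_n^{1/2}$. For a weakly decreasing sequence $\lambda=(\lambda_1,\dots,\lambda_n)$ of non-negative numbers which are either all integers or all in $\mathbb{Z}+\tfrac12$, let $l(\lambda)$ be the number of non-zero $\lambda_i$ and set \[ \mathrm{so}_{2n+1,\lambda}(x)=\frac{\det_{1\le i,j\le n}\big(x_i^{\lambda_j+n-j+1/2}-x_i^{-(\lambda_j+n-j+1/2)}\big)}{\det_{1\le i,j\le n}\big(x_i^{n-j+1/2}-x_i^{-(n-j+1/2)}\big)}, \] \[ \mathrm{so}_{2n,\lambda}(x)=\sum_{\sigma\in\{1,-1\}}\frac{\det_{1\le i,j\le n}\big(\sigma x_i^{\lambda_j+n-j}+x_i^{-(\lambda_j+n-j)}\big)}{\det_{1\le i,j\le n}\big(x_i^{n-j}+x_i^{-(n-j)}\big)}, \] \[ \mathrm{o}_{2n,\lambda}(x)=u_\lambda\,\frac{\det_{1\le i,j\le n}\big(x_i^{\lambda_j+n-j}+x_i^{-(\lambda_j+n-j)}\big)}{\det_{1\le i,j\le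 n}\big(x_i^{n-j}+x_i^{-(n-j)}\big)}, \qquad u_\lambda=\begin{cases}1,& l(\lambda)<n,\\ 2,& l(\lambda)=n.\end{cases} \] Write $(s^n)=(s,\dots,s)$ ($n$ entries), and let $\lambda\subseteq(r^n)$ mean that $\lambda=(\lambda_1,\dots,\lambda_n)$ is a sequence of integers with $r\ge\lambda_1\ge\cdots\ge\lambda_n\ge0$. Then \[ \sum_{\lambda\subseteq(r^n)}\mathrm{so}_{2n,\lambda}(x)=\mathrm{so}_{2n,(s^n)}(x)\,\mathrm{so}_{2n+1,(s^n)}(x),\qquad s:=\tfrac12 r, \] and \[ \sum_{\substack{\lambda\subseteq(r^n)\\ l(\lambda)=n}}\mathrm{o}_{2n,\lambda}(x)=\mathrm{o}_{2n,(s^n)}(x)\,\mathrm{so}_{2n+1,(t^n)}(x),\qquad s:=\tfrac12(r+1),\quad t:=\tfrac12(r-1). \] -/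

import Mathlib

/-- The field of rational functions (over `ℤ`, equivalently over `ℚ`) in the indeterminates
`x₁^(1/2), …, xₙ^(1/2)`: the polynomial generators are the square roots of the variables. -/
abbrev HalfField (n : ℕ) : Type := FractionRing (MvPolynomial (Fin n) ℤ)

/-- The indeterminate `xᵢ^(1/2)`. -/
noncomputable def sqrtX {n : ℕ} (i : Fin n) : HalfField n :=
  algebraMap (MvPolynomial (Fin n) ℤ) (HalfField n) (MvPolynomial.X i)

/-- The power `xᵢ^a` for `a ∈ ½ℤ`, namely `(xᵢ^(1/2))^(2a)` (other values of `a` are irrelevant). -/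
noncomputable def xpow {n : ℕ} (i : Fin n) (a : ℚ) : HalfField n :=
  sqrtX i ^ (2 * a).num

theorem xpow_half {n : ℕ} (i : Fin n) (k : ℤ) : xpow i ((k : ℚ) / 2) = sqrtX i ^ k := by
  have h : (2 : ℚ) * ((k : ℚ) / 2) = (k : ℚ) := by ring
  rw [xpow, h, Rat.num_intCast]

/-- `n - j` for the 1-based column index `j`; an index `j : Fin n` stands for column `j + 1`. -/
def rho {n : ℕ} (j : Fin n) : ℚ := (n : ℚ) - ((j : ℕ) + 1)

/-- The odd-orthogonal Schur function `so_{2n+1,λ}(x)`, for `λ` a partition or half-partition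
`(λ₁, …, λₙ)`. -/
noncomputable def soOdd (n : ℕ) (lam : Fin n → ℚ) : HalfField n :=
  Matrix.det (Matrix.of fun i j : Fin n =>
      xpow i (lam j + rho j + 1 / 2) - xpow i (-(lam j + rho j + 1 / 2))) /
    Matrix.det (Matrix.of fun i j : Fin n =>
      xpow i (rho j + 1 / 2) - xpow i (-(rho j + 1 / 2)))

/-- The even-orthogonal Schur function `so_{2n,λ}(x)`, for `λ` a `Dₙ` partition. -/
noncomputable def soEven (n : ℕ) (lam : Fin n → ℚ) : HalfField n :=
  ∑ σ ∈ ({1, -1} : Finset ℤ),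
    Matrix.det (Matrix.of fun i j : Fin n =>
        (σ : HalfField n) * xpow i (lam j + rho j) + xpow i (-(lam j + rho j))) /
      Matrix.det (Matrix.of fun i j : Fin n => xpow i (rho j) + xpow i (-rho j))

/-- The length `l(λ)`: the number of non-zero entries. -/
def seqLength {n : ℕ} (lam : Fin n → ℚ) : ℕ :=
  (Finset.univ.filter fun i => lam i ≠ 0).card

/-- The even-orthogonal character `o_{2n,λ}(x)`, for `λ` a partition or half-partition;
the factor `u_λ` is `2` if `l(λ) = n` and `1` if `l(λ) < n`. -/
noncomputable def oEven (n : ℕ) (lam : Fin n → ℚ) : HalfField n :=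
  (if seqLength lam = n then 2 else 1) *
    (Matrix.det (Matrix.of fun i j : Fin n =>
        xpow i (lam j + rho j) + xpow i (-(lam j + rho j))) /
      Matrix.det (Matrix.of fun i j : Fin n => xpow i (rho j) + xpow i (-rho j)))

/-- The partitions `λ ⊆ (r^n)`: weakly decreasing sequences `r ≥ λ₁ ≥ ⋯ ≥ λₙ ≥ 0` of integers. -/
def boxPartitions (n r : ℕ) : Finset (Fin n → ℕ) :=
  (Fintype.piFinset fun _ : Fin n => Finset.range (r + 1)).filter
    fun lam => ∀ i j : Fin n, i ≤ j → lam j ≤ lam i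

/-- A partition, seen as a sequence of rational numbers. -/
def toSeq {n : ℕ} (lam : Fin n → ℕ) : Fin n → ℚ := fun i => (lam i : ℚ)

/-- The rectangular sequence `(s^n) = (s, …, s)`. -/
def rect (n : ℕ) (s : ℚ) : Fin n → ℚ := fun _ => s

/-! Write y_i = x_i^(1/2). The core is Macdonald's bounded Littlewood identity: the Schur functions
s_λ(x) with λ ⊆ (r^n) add up to ∏ x_i^(r/2) times the odd character of ((r/2)^n). Expand every even
orthogonal alternant over sign vectors e. The e-term is a type A alternant at x^e, so its sum over λ
is a monomial times the Vandermonde of x^e times an odd character. That character is invariant under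
x_i ↦ 1/x_i, hence the same for all e, and factors out; the monomials and Vandermondes left over are
the sign expansion of the even alternant of a rectangle. Both identities are instances of
`sum_det_orthogonal_alternant`, with (a, R) = (0, r+1) and (1, r). The Littlewood identity
`alternantSum_mul_weylDenominator` goes by induction on n and R: the sequences with λ_1 = R are
split off by Laplace expansion, the odd alternants are expanded over e, and for each e there remains
a partial fraction identity, `sum_one_sub_inv_mul_prod`. -/

/-! ### Partial fractions -/

open Finset in
/-- A partial fraction identity: the divided difference of `∏ (t - 1/xⱼ)` at the nodes `xᵢ`
and `-1`. -/
theorem sum_one_sub_inv_mul_prod {ι K : Type*} [DecidableEq ι] [Field K] (I : Finset ι) (x : ι → K)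
    (h0 : ∀ i, x i ≠ 0) (h1 : ∀ i, x i ≠ -1) (hx : Function.Injective x) :
    ∑ i ∈ I, (1 - (x i)⁻¹) * ∏ j ∈ I.erase i, (x i - (x j)⁻¹) / (x i - x j) =
      1 - ∏ i ∈ I, (x i)⁻¹ := by
  classical
  set f : Polynomial K := ∏ j ∈ I, (Polynomial.X - Polynomial.C (x j)⁻¹) with hf
  have hmon : f.Monic := Polynomial.monic_prod_of_monic _ _ fun j _ => Polynomial.monic_X_sub_C _
  have hdeg : f.degree = (#I : ℕ) := by
    rw [hf, Polynomial.degree_prod]; simp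
  let v : Option ι → K := fun o => o.elim (-1) x
  have hv : Function.Injective v := by
    rintro (_ | a) (_ | b) h
    · rfl
    · exact absurd h.symm (h1 b)
    · exact absurd h (h1 a)
    · exact congrArg some (hx h)
  -- There are #I + 1 nodes for a monic f of degree #I. The node -1 yields ∏ 1/x_i; at x_i the
  -- prefactor is (x_i - 1/x_i)/(x_i + 1) = 1 - 1/x_i.
  have key := Lagrange.leadingCoeff_eq_sum (s := insertNone I) (v := v) hv.injOn (P := f)
    (by rw [hdeg, card_insertNone]; rfl)
  have herase : ∀ i ∈ I, (insertNone I).erase (some i) = insertNone (I.erase i) := by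
    intro i hi; ext (_ | a) <;> simp
  have herase0 : (insertNone I).erase none = I.map Function.Embedding.some := by
    ext (_ | a) <;> simp
  rw [hmon.leadingCoeff, sum_insertNone, herase0, prod_map] at key
  have e0 : Polynomial.eval (v none) f / ∏ i ∈ I, (v none - v (Function.Embedding.some i)) =
      ∏ i ∈ I, (x i)⁻¹ := by
    rw [hf, Polynomial.eval_prod, ← prod_div_distrib]
    refine prod_congr rfl fun i _ => ?_
    have a := h0 i
    have b : -1 - x i ≠ 0 := fun h => h1 i (by linear_combination -h)
    simp only [v, Polynomial.eval_sub, Polynomial.eval_X, Polynomial.eval_C, Option.elim,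
      Function.Embedding.some_apply]
    field_simp
    ring
  rw [e0] at key
  rw [eq_sub_iff_add_eq, add_comm]
  refine Eq.trans ?_ key.symm
  congr 1
  refine sum_congr rfl fun i hi => ?_
  rw [herase i hi, prod_insertNone, hf, Polynomial.eval_prod, ← mul_prod_erase _ _ hi,
    prod_div_distrib]
  simp only [v, Polynomial.eval_sub, Polynomial.eval_X, Polynomial.eval_C, Option.elim]
  have a := h0 i
  have b : x i + 1 ≠ 0 := fun h => h1 i (by linear_combination h)
  have b' : x i - -1 ≠ 0 := by rwa [sub_neg_eq_add]
  have c : ∏ j ∈ I.erase i, (x i - x j) ≠ 0 := prod_ne_zero_iff.2 fun j hj =>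
    sub_ne_zero.2 fun h => (ne_of_mem_erase hj) (hx h).symm
  field_simp
  ring

/-! ### Vandermonde determinants -/

/-- The Vandermonde determinant `det (xᵢ^(n-j))`. -/
def revVandermonde {K : Type*} [CommRing K] {n : ℕ} (x : Fin n → K) : K :=
  Matrix.det (Matrix.of fun i j : Fin n => x i ^ (j.rev : ℕ))

theorem revVandermonde_eq_prod {K : Type*} [CommRing K] {n : ℕ} (x : Fin n → K) :
    revVandermonde x = ∏ i, ∏ j ∈ Finset.Ioi i, (x i - x j) := by
  have h := Matrix.det_projVandermonde (1 : Fin n → K) x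
  simp only [Pi.one_apply, one_mul] at h
  rw [← h, revVandermonde]
  congr 1
  ext i j
  simp [Matrix.projVandermonde_apply]

theorem revVandermonde_ne_zero {K : Type*} [Field K] {n : ℕ} {x : Fin n → K}
    (hx : Function.Injective x) : revVandermonde x ≠ 0 := by
  rw [revVandermonde_eq_prod]
  refine Finset.prod_ne_zero_iff.2 fun i _ => Finset.prod_ne_zero_iff.2 fun j hj =>
    sub_ne_zero.2 fun h => ?_
  exact (Finset.mem_Ioi.1 hj).ne (hx h)

/-- Moving row i to the top is a cycle of sign (-1)^i; the factors of the product formula involving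
the new first row then split off. -/
theorem revVandermonde_succAbove {K : Type*} [CommRing K] {n : ℕ} (x : Fin (n + 1) → K)
    (i : Fin (n + 1)) : revVandermonde x =
      (-1) ^ (i : ℕ) * (∏ j, (x i - x (i.succAbove j))) *
        revVandermonde (fun j => x (i.succAbove j)) := by
  have h := Matrix.det_permute i.cycleRange.symm
    (Matrix.of fun k j : Fin (n + 1) => x k ^ (j.rev : ℕ))
  have h2 : Matrix.det ((Matrix.of fun k j : Fin (n + 1) => x k ^ (j.rev : ℕ)).submatrix
      i.cycleRange.symm id) = revVandermonde (fun k => x (i.cycleRange.symm k)) := rfl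
  rw [h2, Equiv.Perm.sign_symm, Fin.sign_cycleRange, revVandermonde_eq_prod, Fin.prod_univ_succ,
    Fin.prod_Ioi_zero] at h
  simp only [Fin.prod_Ioi_succ, Fin.cycleRange_symm_zero, Fin.cycleRange_symm_succ] at h
  rw [← revVandermonde_eq_prod (fun j => x (i.succAbove j))] at h
  rw [mul_assoc, h, revVandermonde]
  push_cast
  rw [← mul_assoc, ← mul_pow]
  simp

/-! ### Bounded sums of type A alternants -/

/-- Weakly decreasing sequences of `n` natural numbers less than `R`. -/
def decreasingSeqs (n R : ℕ) : Finset (Fin n → ℕ) :=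
  (Fintype.piFinset fun _ : Fin n => Finset.range R).filter
    fun lam => ∀ i j : Fin n, i ≤ j → lam j ≤ lam i

theorem mem_decreasingSeqs {n R : ℕ} {lam : Fin n → ℕ} :
    lam ∈ decreasingSeqs n R ↔ (∀ i, lam i < R) ∧ ∀ i j : Fin n, i ≤ j → lam j ≤ lam i := by
  simp [decreasingSeqs]

/-- The sum of the alternants `det (xᵢ^(λⱼ+n-j))` over weakly decreasing `λ` with entries
less than `R`. -/
def alternantSum {K : Type*} [CommRing K] (n R : ℕ) (x : Fin n → K) : K :=
  ∑ lam ∈ decreasingSeqs n R, Matrix.det (Matrix.of fun i j => x i ^ (lam j + (j.rev : ℕ)))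

theorem alternantSum_zero_left {K : Type*} [CommRing K] (R : ℕ) (x : Fin 0 → K) :
    alternantSum 0 R x = 1 := by
  have : decreasingSeqs 0 R = {Fin.elim0} := by
    ext l; simp [mem_decreasingSeqs, Subsingleton.elim l Fin.elim0]
  simp [alternantSum, this]

theorem alternantSum_succ_zero {K : Type*} [CommRing K] (n : ℕ) (x : Fin (n + 1) → K) :
    alternantSum (n + 1) 0 x = 0 := by
  refine Finset.sum_eq_zero fun l hl => ?_
  exact absurd ((mem_decreasingSeqs.1 hl).1 0) (Nat.not_lt_zero _)

theorem decreasingSeqs_succ (n R : ℕ) : decreasingSeqs (n + 1) (R + 1) =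
    decreasingSeqs (n + 1) R ∪ (decreasingSeqs n (R + 1)).image (fun l => (Fin.cons R l : Fin (n + 1) → ℕ)) := by
  ext l
  simp only [Finset.mem_union, Finset.mem_image, mem_decreasingSeqs]
  constructor
  · rintro ⟨h1, h2⟩
    by_cases h : l 0 = R
    · refine Or.inr ⟨Fin.tail l, ⟨fun i => h1 _, fun i j hij => h2 _ _ (by simpa using hij)⟩, ?_⟩
      rw [← h, Fin.cons_self_tail]
    · refine Or.inl ⟨fun i => ?_, h2⟩
      have := h2 0 i (Fin.zero_le _)
      have := h1 0
      omega
  · rintro (⟨h1, h2⟩ | ⟨m, ⟨h1, h2⟩, rfl⟩)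
    · exact ⟨fun i => (h1 i).trans (Nat.lt_succ_self _), h2⟩
    · refine ⟨fun i => ?_, fun i j => ?_⟩
      · cases i using Fin.cases with
        | zero => simp
        | succ i => simpa using h1 i
      · cases i using Fin.cases with
        | zero =>
          cases j using Fin.cases with
          | zero => simp
          | succ j => intro _; simpa using Nat.lt_succ_iff.1 (h1 j)
        | succ i =>
          cases j using Fin.cases with
          | zero => intro h; exact absurd h (by simp)
          | succ j => intro h; simpa using h2 i j (by simpa using h)

/-- The new sequences are those with λ_1 = R, whose first column is x_i^(R+n); Laplace expansion
along it leaves sums in n variables. -/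
theorem alternantSum_succ_succ {K : Type*} [CommRing K] (n R : ℕ) (x : Fin (n + 1) → K) :
    alternantSum (n + 1) (R + 1) x = alternantSum (n + 1) R x +
      ∑ i : Fin (n + 1), (-1) ^ (i : ℕ) * x i ^ (R + n) *
        alternantSum n (R + 1) (fun j => x (i.succAbove j)) := by
  have hd : Disjoint (decreasingSeqs (n + 1) R)
      ((decreasingSeqs n (R + 1)).image (fun l => (Fin.cons R l : Fin (n + 1) → ℕ))) := by
    rw [Finset.disjoint_left]
    intro l hl hl'
    obtain ⟨m, -, rfl⟩ := Finset.mem_image.1 hl'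
    simpa using (mem_decreasingSeqs.1 hl).1 0
  rw [alternantSum, decreasingSeqs_succ, Finset.sum_union hd,
    Finset.sum_image (fun a _ b _ h => Fin.cons_right_injective (α := fun _ => ℕ) _ h)]
  congr 1
  simp only [alternantSum, Finset.mul_sum]
  rw [Finset.sum_comm]
  refine Finset.sum_congr rfl fun l _ => ?_
  rw [Matrix.det_succ_column_zero]
  refine Finset.sum_congr rfl fun i _ => ?_
  simp only [Matrix.of_apply, Fin.cons_zero, Fin.rev_zero, Fin.val_last]
  congr 2
  ext a b
  simp

/-! ### Regular points and inversion of variables -/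

/-- The condition that no factor of the Weyl denominator of type `B` vanishes at `x`, and no `xᵢ`
is `-1`. -/
structure IsRegularPoint {K : Type*} [Field K] {n : ℕ} (x : Fin n → K) : Prop where
  ne_zero : ∀ i, x i ≠ 0
  mul_ne_one : ∀ i j, x i * x j ≠ 1
  injective : Function.Injective x

namespace IsRegularPoint

variable {K : Type*} [Field K] {n : ℕ}

theorem comp {m : ℕ} {x : Fin n → K} (h : IsRegularPoint x) {f : Fin m → Fin n}
    (hf : Function.Injective f) : IsRegularPoint (fun i => x (f i)) :=
  ⟨fun _ => h.ne_zero _, fun _ _ => h.mul_ne_one _ _, h.injective.comp hf⟩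

theorem add_inv_injective {x : Fin n → K} (h : IsRegularPoint x) :
    Function.Injective fun i => x i + (x i)⁻¹ := by
  intro i j hij
  have hi := h.ne_zero i
  have hj := h.ne_zero j
  have : (x i - x j) * (x i * x j - 1) = 0 := by
    simp only at hij
    field_simp at hij
    linear_combination hij
  rcases mul_eq_zero.1 this with h' | h'
  · exact h.injective (sub_eq_zero.1 h')
  · exact absurd (sub_eq_zero.1 h') (h.mul_ne_one i j)

theorem zpow_sub_ne_zero {x : Fin n → K} (h : IsRegularPoint x) {i j : Fin n} (hij : i ≠ j)
    (e : ℤˣ) : x i - x j ^ (e : ℤ) ≠ 0 := by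
  rcases Int.units_eq_one_or e with rfl | rfl
  · simpa [sub_eq_zero] using fun h' => hij (h.injective h')
  · have hj := h.ne_zero j
    intro h'
    apply h.mul_ne_one i j
    simp only [Units.val_neg, Units.val_one, zpow_neg, zpow_one] at h'
    rw [sub_eq_zero.1 h', inv_mul_cancel₀ hj]

theorem ne_neg_one {x : Fin n → K} (h : IsRegularPoint x) (i : Fin n) : x i ≠ -1 :=
  fun h' => h.mul_ne_one i i (by rw [h']; ring)

/-- The only new danger is x_i / x_j = 1 or x_i = 1 / x_j. The former would force i = j, while the
signs at i and j differ; the latter is excluded by hypothesis. -/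
theorem zpow_units {x : Fin n → K} (h : IsRegularPoint x) (e : Fin n → ℤˣ) :
    IsRegularPoint (fun i => x i ^ (e i : ℤ)) := by
  refine ⟨fun i => zpow_ne_zero _ (h.ne_zero i), fun i j => ?_, fun i j => ?_⟩
  · have hi := h.ne_zero i
    have hj := h.ne_zero j
    have h1 := h.mul_ne_one i j
    rcases Int.units_eq_one_or (e i) with a | a <;> rcases Int.units_eq_one_or (e j) with b | b <;>
      simp only [a, b, Units.val_neg, Units.val_one, zpow_neg, zpow_one]
    · exact h1
    · intro h'
      have hij : x i = x j := by field_simp at h'; exact h'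
      obtain rfl := h.injective hij
      rw [a] at b
      exact absurd b (by decide)
    · intro h'
      have hij : x i = x j := by field_simp at h'; exact h'.symm
      obtain rfl := h.injective hij
      rw [a] at b
      exact absurd b (by decide)
    · intro h'
      exact h1 (by rw [← mul_inv, inv_eq_one] at h'; exact h')
  · have hi := h.ne_zero i
    have hj := h.ne_zero j
    have h1 := h.mul_ne_one i j
    rcases Int.units_eq_one_or (e i) with a | a <;> rcases Int.units_eq_one_or (e j) with b | b <;>
      simp only [a, b, Units.val_neg, Units.val_one, zpow_neg, zpow_one]
    · exact fun h' => h.injective h'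
    · intro h'
      exact absurd (by rw [h', inv_mul_cancel₀ hj]) h1
    · intro h'
      exact absurd (by rw [← h', mul_inv_cancel₀ hi]) h1
    · exact fun h' => h.injective (inv_injective h')

end IsRegularPoint

-- Factors with e_j = -1 have equal numerator and denominator, so only the indices with e_j = 1
-- survive and the partial fraction identity applies to them.
open Finset in
theorem sum_units_one_sub_inv_mul_prod {K : Type*} [Field K] {n : ℕ} {x : Fin (n + 1) → K}
    (h : IsRegularPoint x) (e : Fin (n + 1) → ℤˣ) :
    ∑ i, (if e i = 1 then (1 - (x i)⁻¹) * ∏ j : Fin n, (x i - (x (i.succAbove j))⁻¹) /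
        (x i - x (i.succAbove j) ^ (e (i.succAbove j) : ℤ)) else 0) =
      1 - ∏ i, (if e i = 1 then (x i)⁻¹ else 1) := by
  rw [← prod_filter, ← sum_filter, ← sum_one_sub_inv_mul_prod _ x h.ne_zero h.ne_neg_one h.injective]
  refine sum_congr rfl fun i hi => ?_
  congr 1
  have hu : (univ : Finset (Fin (n + 1))).erase i = univ.map i.succAboveEmb := by
    rw [Fin.univ_succAbove _ i, erase_cons]
  refine (prod_map univ i.succAboveEmb
    (fun k => (x i - (x k)⁻¹) / (x i - x k ^ (e k : ℤ)))).symm.trans ?_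
  rw [← hu]
  symm
  refine (prod_congr rfl fun j hj => ?_).trans
    (prod_subset (f := fun k => (x i - (x k)⁻¹) / (x i - x k ^ (e k : ℤ)))
      (erase_subset_erase i (filter_subset _ _)) fun j hj hj' => ?_)
  · have : e j = 1 := by simpa using (mem_erase.1 hj).2
    simp [this]
  · have hji := ne_of_mem_erase hj
    have : e j = -1 := (Int.units_eq_one_or (e j)).resolve_left fun h1 =>
      hj' (mem_erase.2 ⟨hji, by simpa using h1⟩)
    have h2 := h.zpow_sub_ne_zero hji.symm (-1)
    simp only [this, Units.val_neg, Units.val_one, zpow_neg, zpow_one] at h2 ⊢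
    exact div_self h2

/-! ### Sign expansions of orthogonal alternants -/

/-- The alternant `det (y_i^(R+2(n-j)) - y_i^(-(R+2(n-j))))` of type `B`. -/
def oddAlternant {K : Type*} [Field K] {n : ℕ} (R : ℤ) (y : Fin n → K) : K :=
  Matrix.det (Matrix.of fun i j : Fin n =>
    y i ^ (R + 2 * (j.rev : ℕ)) - y i ^ (-(R + 2 * (j.rev : ℕ))))

open Finset in
/-- Expansion of an orthogonal alternant over the choices of signs of the exponents. -/
theorem det_mul_zpow_add {K : Type*} [Field K] {n : ℕ} (w : ℤˣ → K) (k : Fin n → ℤ)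
    (y : Fin n → K) :
    Matrix.det (Matrix.of fun i j : Fin n => w 1 * y i ^ k j + w (-1) * y i ^ (-k j)) =
      ∑ e : Fin n → ℤˣ, (∏ i, w (e i)) *
        Matrix.det (Matrix.of fun i j : Fin n => (y i ^ (e i : ℤ)) ^ k j) := by
  have h1 : (Matrix.of fun i j : Fin n => w 1 * y i ^ k j + w (-1) * y i ^ (-k j)) =
      fun i => ∑ u : ℤˣ, fun j => w u * (y i ^ (u : ℤ)) ^ k j := by
    ext i j
    rw [Finset.sum_apply]
    simp [UnitsInt.univ, zpow_neg]
  rw [h1]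
  have h2 := (Matrix.detRowAlternating (n := Fin n) (R := K)).toMultilinearMap.map_sum
    (α := fun _ => ℤˣ) (fun i u j => w u * (y i ^ (u : ℤ)) ^ k j)
  refine h2.trans (sum_congr rfl fun e _ => ?_)
  exact Matrix.det_mul_column (fun i => w (e i)) (Matrix.of fun i j => (y i ^ (e i : ℤ)) ^ k j)

open Finset in
theorem det_zpow_add_two_mul {K : Type*} [Field K] {n : ℕ} (a : ℤ) {y : Fin n → K}
    (hy : ∀ i, y i ≠ 0) :
    Matrix.det (Matrix.of fun i j : Fin n => y i ^ (a + 2 * (j.rev : ℕ))) =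
      (∏ i, y i ^ a) * revVandermonde (fun i => y i ^ 2) := by
  rw [revVandermonde, ← Matrix.det_mul_column]
  congr 1
  ext i j
  simp only [Matrix.of_apply]
  rw [zpow_add₀ (hy i), ← pow_mul]
  norm_cast

theorem oddAlternant_eq_sum {K : Type*} [Field K] {n : ℕ} (R : ℤ) {y : Fin n → K}
    (hy : ∀ i, y i ≠ 0) :
    oddAlternant R y = ∑ e : Fin n → ℤˣ, (∏ i, ((e i : ℤ) : K) * (y i ^ (e i : ℤ)) ^ R) *
      revVandermonde (fun i => (y i ^ 2) ^ (e i : ℤ)) := by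
  have h := det_mul_zpow_add (fun u => ((u : ℤ) : K)) (fun j : Fin n => R + 2 * (j.rev : ℕ)) y
  rw [oddAlternant]
  refine Eq.trans ?_ (h.trans ?_)
  · congr 1
    ext i j
    simp [sub_eq_add_neg]
  · refine Finset.sum_congr rfl fun e _ => ?_
    rw [det_zpow_add_two_mul R fun i => zpow_ne_zero _ (hy i), Finset.prod_mul_distrib, mul_assoc]
    congr 3
    ext i
    rw [← zpow_natCast, ← zpow_natCast, zpow_comm]

/-- Inverting y_i negates row i. The sign is independent of R, so ratios of odd alternants are
invariant. -/
theorem oddAlternant_zpow_units {K : Type*} [Field K] {n : ℕ} (R : ℤ) (y : Fin n → K)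
    (e : Fin n → ℤˣ) :
    oddAlternant R (fun i => y i ^ (e i : ℤ)) = (∏ i, ((e i : ℤ) : K)) * oddAlternant R y := by
  rw [oddAlternant, oddAlternant, ← Matrix.det_mul_column]
  congr 1
  ext i j
  rcases Int.units_eq_one_or (e i) with a | a <;> simp [a]

/-- Extending e by e_i = 1 gives the sums for different i a common index set, so that they can be
interchanged with the sum over i. -/
theorem sum_fin_units_eq_sum_ite {M : Type*} [AddCommMonoid M] {n : ℕ} (i : Fin (n + 1))
    (f : (Fin n → ℤˣ) → M) :
    ∑ e : Fin n → ℤˣ, f e =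
      ∑ e : Fin (n + 1) → ℤˣ, if e i = 1 then f (fun j => e (i.succAbove j)) else 0 := by
  rw [← (Fin.insertNthEquiv (fun _ => ℤˣ) i).sum_comp, Fintype.sum_prod_type, UnitsInt.univ,
    Finset.sum_pair (by decide)]
  simp [Fin.insertNthEquiv]

/-! ### Macdonald's bounded Littlewood identity -/

open Finset in
/-- One term in the recurrence for the sum side of Macdonald's bounded Littlewood identity. -/
theorem expansion_term_succAbove {K : Type*} [Field K] {n : ℕ} (R : ℕ) {y : Fin (n + 1) → K}
    (h : IsRegularPoint fun i => y i ^ 2) (hy : ∀ i, y i ≠ 0) (i : Fin (n + 1))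
    (e : Fin (n + 1) → ℤˣ) (he : e i = 1) :
    (-1) ^ (i : ℕ) * (y i ^ 2) ^ (R + n) *
        (revVandermonde (fun j => y (i.succAbove j) ^ 2) *
          (∏ j, y (i.succAbove j) ^ (R : ℤ)) *
          ((∏ j, ((e (i.succAbove j) : ℤ) : K) *
              (y (i.succAbove j) ^ (e (i.succAbove j) : ℤ)) ^ ((R : ℤ) + 1)) *
            revVandermonde (fun j => (y (i.succAbove j) ^ 2) ^ (e (i.succAbove j) : ℤ)))) *
        (revVandermonde (fun i => y i ^ 2 + (y i ^ 2)⁻¹) * ∏ i, (y i - (y i)⁻¹)) =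
      (revVandermonde (fun j => y (i.succAbove j) ^ 2 + (y (i.succAbove j) ^ 2)⁻¹) *
          ∏ j, (y (i.succAbove j) - (y (i.succAbove j))⁻¹)) *
        (revVandermonde (fun i => y i ^ 2) * (∏ i, y i ^ ((R : ℤ) - 1)) *
          ((∏ i, ((e i : ℤ) : K) * (y i ^ (e i : ℤ)) ^ (R : ℤ)) *
            revVandermonde (fun i => (y i ^ 2) ^ (e i : ℤ))) *
          (∏ i, y i * y i ^ (e i : ℤ)) *
          ((1 - (y i ^ 2)⁻¹) * ∏ j : Fin n, (y i ^ 2 - (y (i.succAbove j) ^ 2)⁻¹) /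
            (y i ^ 2 - (y (i.succAbove j) ^ 2) ^ (e (i.succAbove j) : ℤ)))) := by
  set y' : Fin n → K := fun j => y (i.succAbove j) with hy'
  set e' : Fin n → ℤˣ := fun j => e (i.succAbove j) with he'
  have hy'0 : ∀ j, y' j ≠ 0 := fun j => hy _
  have hyi := hy i
  simp only [show ∀ j, y (i.succAbove j) = y' j from fun _ => rfl,
    show ∀ j, e (i.succAbove j) = e' j from fun _ => rfl]
  rw [revVandermonde_succAbove (fun i => y i ^ 2) i,
    revVandermonde_succAbove (fun i => y i ^ 2 + (y i ^ 2)⁻¹) i,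
    revVandermonde_succAbove (fun i => (y i ^ 2) ^ (e i : ℤ)) i]
  simp only [Fin.prod_univ_succAbove _ i,
    show ∀ j, y (i.succAbove j) = y' j from fun _ => rfl,
    show ∀ j, e (i.succAbove j) = e' j from fun _ => rfl, he]
  have hR : ∏ j, y' j ^ (R : ℤ) = (∏ j, y' j ^ ((R : ℤ) - 1)) * ∏ j, y' j := by
    rw [← prod_mul_distrib]
    exact prod_congr rfl fun j _ => by rw [← zpow_add_one₀ (hy'0 j), sub_add_cancel]
  have hE : ∏ j, ((e' j : ℤ) : K) * (y' j ^ (e' j : ℤ)) ^ ((R : ℤ) + 1) =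
      (∏ j, ((e' j : ℤ) : K) * (y' j ^ (e' j : ℤ)) ^ (R : ℤ)) * ∏ j, y' j ^ (e' j : ℤ) := by
    rw [← prod_mul_distrib]
    exact prod_congr rfl fun j _ => by
      rw [zpow_add_one₀ (zpow_ne_zero _ (hy'0 j)), mul_assoc]
  have hZ : (y i ^ 2) ^ n * ∏ j, (y i ^ 2 + (y i ^ 2)⁻¹ - (y' j ^ 2 + (y' j ^ 2)⁻¹)) =
      (∏ j, (y i ^ 2 - y' j ^ 2)) * ∏ j, (y i ^ 2 - (y' j ^ 2)⁻¹) := by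
    have : (y i ^ 2) ^ n = ∏ _j : Fin n, y i ^ 2 := by simp
    rw [this, ← prod_mul_distrib, ← prod_mul_distrib]
    refine prod_congr rfl fun j _ => ?_
    have := hy'0 j
    field_simp
    ring
  -- As e_i = 1, these are the factors of the Vandermonde of x^e that involve index i; they cancel
  -- the partial fraction denominators.
  have hB : ∏ j, (y i ^ 2 - (y' j ^ 2) ^ (e' j : ℤ)) ≠ 0 := prod_ne_zero_iff.2 fun j _ =>
    h.zpow_sub_ne_zero (Fin.succAbove_ne i j).symm (e' j)
  rw [hR, hE, prod_mul_distrib (f := y'), prod_div_distrib]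
  simp only [Units.val_one, zpow_one, Int.cast_one, one_mul]
  set A := ∏ j, (y i ^ 2 - y' j ^ 2)
  set H := ∏ j, (y i ^ 2 - (y' j ^ 2)⁻¹)
  set B := ∏ j, (y i ^ 2 - (y' j ^ 2) ^ (e' j : ℤ))
  set Z := ∏ j, (y i ^ 2 + (y i ^ 2)⁻¹ - (y' j ^ 2 + (y' j ^ 2)⁻¹))
  generalize (∏ j, y' j ^ ((R : ℤ) - 1)) = P1
  generalize (∏ j, ((e' j : ℤ) : K) * (y' j ^ (e' j : ℤ)) ^ (R : ℤ)) = P2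
  generalize (∏ j, y' j ^ (e' j : ℤ)) = P3
  generalize (∏ j, (y' j - (y' j)⁻¹)) = P4
  generalize (∏ j, y' j) = P5
  generalize revVandermonde (fun j => y' j ^ 2) = V1
  generalize revVandermonde (fun j => (y' j ^ 2) ^ (e' j : ℤ)) = V2
  generalize revVandermonde (fun j => y' j ^ 2 + (y' j ^ 2)⁻¹) = V3
  have hs : ((-1 : K) ^ (i : ℕ)) * (-1) ^ (i : ℕ) = 1 := by rw [← mul_pow]; simp
  generalize ((-1 : K) ^ (i : ℕ)) = s at *
  rw [zpow_sub_one₀ hyi, zpow_natCast, pow_add]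
  have key : (y i ^ 2) ^ R * (y i - (y i)⁻¹) =
      y i ^ R * (y i)⁻¹ * y i ^ R * (y i * y i) * (1 - (y i ^ 2)⁻¹) := by
    field_simp
    ring
  calc _ = s * s * ((y i ^ 2) ^ R * (y i - (y i)⁻¹)) * ((y i ^ 2) ^ n * Z) *
        (V1 * V2 * V3 * P1 * P2 * P3 * P4 * P5) := by ring
    _ = s * s * (y i ^ R * (y i)⁻¹ * y i ^ R * (y i * y i) * (1 - (y i ^ 2)⁻¹)) * (A * H) *
        (V1 * V2 * V3 * P1 * P2 * P3 * P4 * P5) * (B / B) := by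
      rw [key, hZ, div_self hB, mul_one]
    _ = _ := by ring

open Finset in
/-- Macdonald's bounded Littlewood identity, in bialternant form. -/
theorem alternantSum_mul_weylDenominator {K : Type*} [Field K] {n : ℕ} (R : ℕ) {y : Fin n → K}
    (h : IsRegularPoint fun i => y i ^ 2) :
    alternantSum n R (fun i => y i ^ 2) *
        (revVandermonde (fun i => y i ^ 2 + (y i ^ 2)⁻¹) * ∏ i, (y i - (y i)⁻¹)) =
      revVandermonde (fun i => y i ^ 2) * (∏ i, y i ^ ((R : ℤ) - 1)) * oddAlternant R y := by
  induction n generalizing R with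
  | zero => simp [alternantSum_zero_left, revVandermonde, oddAlternant]
  | succ n ihn =>
  have hy : ∀ i, y i ≠ 0 := fun i hi => h.ne_zero i (by simp [hi])
  induction R with
  | zero =>
    -- For R = 0 the last column has exponent 0, so the odd alternant vanishes like the empty sum.
    rw [alternantSum_succ_zero, zero_mul, oddAlternant,
      Matrix.det_eq_zero_of_column_eq_zero (Fin.last n) (by simp), mul_zero]
  | succ R ih =>
  have hterm : ∀ i : Fin (n + 1), (-1) ^ (i : ℕ) * (y i ^ 2) ^ (R + n) *
      alternantSum n (R + 1) (fun j => y (i.succAbove j) ^ 2) *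
        (revVandermonde (fun i => y i ^ 2 + (y i ^ 2)⁻¹) * ∏ i, (y i - (y i)⁻¹)) =
      ∑ e : Fin (n + 1) → ℤˣ, if e i = 1 then
        revVandermonde (fun i => y i ^ 2) * (∏ i, y i ^ ((R : ℤ) - 1)) *
          ((∏ i, ((e i : ℤ) : K) * (y i ^ (e i : ℤ)) ^ (R : ℤ)) *
            revVandermonde (fun i => (y i ^ 2) ^ (e i : ℤ))) *
          (∏ i, y i * y i ^ (e i : ℤ)) *
          ((1 - (y i ^ 2)⁻¹) * ∏ j : Fin n, (y i ^ 2 - (y (i.succAbove j) ^ 2)⁻¹) /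
            (y i ^ 2 - (y (i.succAbove j) ^ 2) ^ (e (i.succAbove j) : ℤ))) else 0 := by
    intro i
    have h' : IsRegularPoint fun j => y (i.succAbove j) ^ 2 :=
      h.comp (f := i.succAbove) Fin.succAbove_right_injective
    have hD : revVandermonde (fun j => y (i.succAbove j) ^ 2 + (y (i.succAbove j) ^ 2)⁻¹) *
        ∏ j, (y (i.succAbove j) - (y (i.succAbove j))⁻¹) ≠ 0 := by
      refine mul_ne_zero (revVandermonde_ne_zero h'.add_inv_injective)
        (prod_ne_zero_iff.2 fun j _ hj => h.mul_ne_one (i.succAbove j) (i.succAbove j) ?_)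
      have h0 := hy (i.succAbove j)
      field_simp at hj
      have hj' : y (i.succAbove j) ^ 2 = 1 := by linear_combination hj
      simp [hj']
    apply mul_left_cancel₀ hD
    rw [mul_sum]
    have e1 := ihn (R + 1) h'
    calc _ = (-1) ^ (i : ℕ) * (y i ^ 2) ^ (R + n) *
        (alternantSum n (R + 1) (fun j => y (i.succAbove j) ^ 2) *
        (revVandermonde (fun j => y (i.succAbove j) ^ 2 + (y (i.succAbove j) ^ 2)⁻¹) *
        ∏ j, (y (i.succAbove j) - (y (i.succAbove j))⁻¹))) *
        (revVandermonde (fun i => y i ^ 2 + (y i ^ 2)⁻¹) * ∏ i, (y i - (y i)⁻¹)) := by ring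
      _ = _ := by
        rw [e1, oddAlternant_eq_sum _ fun j => hy _, mul_sum, mul_sum, sum_mul,
          sum_fin_units_eq_sum_ite i]
        refine sum_congr rfl fun e _ => ?_
        split_ifs with he
        · rw [← expansion_term_succAbove R h hy i e he]
          push_cast
          rw [add_sub_cancel_right]
        · rw [mul_zero]
  rw [alternantSum_succ_succ, add_mul, ih, sum_mul, sum_congr rfl fun i _ => hterm i, sum_comm,
    oddAlternant_eq_sum _ hy, oddAlternant_eq_sum _ hy, mul_sum, mul_sum, ← sum_add_distrib]
  refine sum_congr rfl fun e _ => ?_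
  -- Let M be the product of the x_i with e_i = 1. Passing from R to R + 1 multiplies the e-term by
  -- M, and the increment is M (1 - 1/M) = M - 1 times the old term.
  have h1 := sum_units_one_sub_inv_mul_prod h e
  simp only [← mul_ite_zero, ← mul_sum] at h1 ⊢
  rw [h1]
  have h2 : (∏ i, y i * y i ^ (e i : ℤ)) * ∏ i, (if e i = 1 then (y i ^ 2)⁻¹ else 1) = 1 := by
    rw [← prod_mul_distrib]
    refine prod_eq_one fun i _ => ?_
    have := hy i
    rcases Int.units_eq_one_or (e i) with a | a
    · simp only [a, if_true, Units.val_one, zpow_one]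
      field_simp
    · simp [a, this]
  have h3 : (∏ i, y i ^ (((R + 1 : ℕ) : ℤ) - 1)) *
      (∏ i, ((e i : ℤ) : K) * (y i ^ (e i : ℤ)) ^ ((R + 1 : ℕ) : ℤ)) =
      (∏ i, y i ^ ((R : ℤ) - 1)) * (∏ i, ((e i : ℤ) : K) * (y i ^ (e i : ℤ)) ^ (R : ℤ)) *
        ∏ i, y i * y i ^ (e i : ℤ) := by
    rw [← prod_mul_distrib, ← prod_mul_distrib, ← prod_mul_distrib]
    refine prod_congr rfl fun i _ => ?_
    push_cast
    rw [zpow_add_one₀ (zpow_ne_zero _ (hy i)), add_sub_cancel_right, zpow_sub_one₀ (hy i)]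
    have := hy i
    field_simp
  linear_combination (revVandermonde fun i => (y i ^ 2) ^ (e i : ℤ)) *
    (revVandermonde fun i => y i ^ 2) * (-h3) - (revVandermonde fun i => y i ^ 2) *
    (∏ i, y i ^ ((R : ℤ) - 1)) * ((∏ i, ((e i : ℤ) : K) * (y i ^ (e i : ℤ)) ^ (R : ℤ)) *
            revVandermonde (fun i => (y i ^ 2) ^ (e i : ℤ))) * h2

theorem alternantSum_one {K : Type*} [CommRing K] {n : ℕ} (x : Fin n → K) :
    alternantSum n 1 x = revVandermonde x := by
  have : decreasingSeqs n 1 = {0} := by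
    ext l
    simp only [mem_decreasingSeqs, Nat.lt_one_iff, Finset.mem_singleton]
    exact ⟨fun h => funext h.1, fun h => by simp [h]⟩
  simp [alternantSum, this, revVandermonde]

/-- The type B Weyl denominator formula is the case R = 1 of the bounded identity, where only λ = 0
occurs. -/
theorem oddAlternant_one {K : Type*} [Field K] {n : ℕ} {y : Fin n → K}
    (h : IsRegularPoint fun i => y i ^ 2) :
    oddAlternant 1 y =
      revVandermonde (fun i => y i ^ 2 + (y i ^ 2)⁻¹) * ∏ i, (y i - (y i)⁻¹) := by
  have h1 := alternantSum_mul_weylDenominator 1 h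
  rw [alternantSum_one] at h1
  have h2 := mul_left_cancel₀ (revVandermonde_ne_zero h.injective)
    (h1.trans (mul_assoc _ _ _))
  simpa using h2.symm

theorem oddAlternant_one_ne_zero {K : Type*} [Field K] {n : ℕ} {y : Fin n → K}
    (h : IsRegularPoint fun i => y i ^ 2) : oddAlternant 1 y ≠ 0 := by
  rw [oddAlternant_one h]
  refine mul_ne_zero (revVandermonde_ne_zero h.add_inv_injective)
    (Finset.prod_ne_zero_iff.2 fun i _ hi => h.mul_ne_one i i ?_)
  have h0 : y i ≠ 0 := fun h' => h.ne_zero i (by simp [h'])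
  field_simp at hi
  have hj : y i ^ 2 = 1 := by linear_combination hi
  simp [hj]

theorem alternantSum_eq {K : Type*} [Field K] {n : ℕ} (R : ℕ) {y : Fin n → K}
    (h : IsRegularPoint fun i => y i ^ 2) :
    alternantSum n R (fun i => y i ^ 2) =
      (∏ i, y i ^ ((R : ℤ) - 1)) * revVandermonde (fun i => y i ^ 2) *
        (oddAlternant R y / oddAlternant 1 y) := by
  have h1 := alternantSum_mul_weylDenominator R h
  rw [← oddAlternant_one h] at h1
  rw [← mul_div_assoc, eq_div_iff (oddAlternant_one_ne_zero h), h1]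
  ring

/-! ### Factorization of bounded sums of even orthogonal alternants -/

open Finset in
/-- The bounded sum of even orthogonal alternants, with the columns shifted by `a`, factors as an
even orthogonal alternant times an odd orthogonal character. -/
theorem sum_det_orthogonal_alternant {K : Type*} [Field K] {n : ℕ} (w : ℤˣ → K) (a R : ℕ)
    {y : Fin n → K} (h : IsRegularPoint fun i => y i ^ 2) :
    ∑ lam ∈ decreasingSeqs n R, Matrix.det (Matrix.of fun i j : Fin n =>
        w 1 * y i ^ (2 * ((lam j : ℤ) + a + (j.rev : ℕ))) +
          w (-1) * y i ^ (-(2 * ((lam j : ℤ) + a + (j.rev : ℕ))))) =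
      Matrix.det (Matrix.of fun i j : Fin n =>
        w 1 * y i ^ (2 * (a : ℤ) + (R - 1) + 2 * (j.rev : ℕ)) +
          w (-1) * y i ^ (-(2 * (a : ℤ) + (R - 1) + 2 * (j.rev : ℕ)))) *
        (oddAlternant R y / oddAlternant 1 y) := by
  have hy : ∀ i, y i ≠ 0 := fun i hi => h.ne_zero i (by simp [hi])
  have hye : ∀ (e : Fin n → ℤˣ) i, y i ^ (e i : ℤ) ≠ 0 := fun e i => zpow_ne_zero _ (hy i)
  rw [det_mul_zpow_add w (fun j : Fin n => 2 * (a : ℤ) + (R - 1) + 2 * (j.rev : ℕ)), sum_mul]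
  refine (sum_congr rfl fun lam _ => det_mul_zpow_add w
    (fun j : Fin n => 2 * ((lam j : ℤ) + a + (j.rev : ℕ))) y).trans ?_
  rw [sum_comm]
  refine sum_congr rfl fun e _ => ?_
  rw [← mul_sum, mul_assoc]
  congr 1
  have hreg : IsRegularPoint fun i => (y i ^ (e i : ℤ)) ^ 2 := by
    have := h.zpow_units e
    convert this using 2 with i
    rw [← zpow_natCast, ← zpow_natCast, zpow_comm]
  have hsum := alternantSum_eq R hreg
  -- The signs cancel in the ratio, so the odd character no longer depends on e.
  rw [oddAlternant_zpow_units, oddAlternant_zpow_units, mul_div_mul_left] at hsum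
  · rw [det_zpow_add_two_mul _ (hye e)]
    have h1 : ∀ lam : Fin n → ℕ, Matrix.det (Matrix.of fun i j : Fin n =>
        (y i ^ (e i : ℤ)) ^ (2 * ((lam j : ℤ) + a + (j.rev : ℕ)))) =
        (∏ i, (y i ^ (e i : ℤ)) ^ (2 * (a : ℤ))) * Matrix.det (Matrix.of fun i j : Fin n =>
          ((y i ^ (e i : ℤ)) ^ 2) ^ (lam j + (j.rev : ℕ))) := by
      intro lam
      rw [← Matrix.det_mul_column]
      congr 1
      ext i j
      simp only [Matrix.of_apply]
      rw [← pow_mul, ← zpow_natCast _ (2 * _), ← zpow_add₀ (hye e i)]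
      congr 1
      push_cast
      ring
    rw [sum_congr rfl fun lam _ => h1 lam, ← mul_sum]
    refine (congrArg _ hsum).trans ?_
    rw [← mul_assoc, ← mul_assoc, ← prod_mul_distrib]
    congr 3
    exact funext fun i => (zpow_add₀ (hye e i) _ _).symm
  · refine prod_ne_zero_iff.2 fun i _ => ?_
    rcases Int.units_eq_one_or (e i) with hu | hu <;> simp [hu]

/-! ### Specialization to the indeterminates -/

theorem isRegularPoint_sqrtX (n : ℕ) : IsRegularPoint fun i : Fin n => (sqrtX i : HalfField n) ^ 2 := by
  have hinj := IsFractionRing.injective (MvPolynomial (Fin n) ℤ) (HalfField n)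
  refine ⟨fun i => ?_, fun i j hij => ?_, fun i j hij => ?_⟩
  · refine pow_ne_zero _ ?_
    rw [sqrtX, Ne, map_eq_zero_iff _ hinj]
    exact MvPolynomial.X_ne_zero i
  · simp only [sqrtX, ← map_pow, ← map_mul] at hij
    have h1 := congrArg (MvPolynomial.eval fun _ => (0 : ℤ))
      (hinj (hij.trans (map_one _).symm))
    simp at h1
  · simp only [sqrtX, ← map_pow] at hij
    by_contra hne
    have h1 := congrArg (MvPolynomial.eval fun k => if k = i then (1 : ℤ) else 0) (hinj hij)
    simp [Ne.symm hne] at h1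

theorem rho_eq_rev {n : ℕ} (j : Fin n) : rho j = ((j.rev : ℕ) : ℚ) := by
  rw [rho, Fin.val_rev, Nat.cast_sub (by omega)]
  push_cast
  ring

theorem xpow_eq_zpow {n : ℕ} (i : Fin n) {a : ℚ} {k : ℤ} (h : 2 * a = k) :
    xpow i a = sqrtX i ^ k := by
  rw [← xpow_half, ← h]
  congr 1
  ring

theorem xpow_neg_eq_zpow {n : ℕ} (i : Fin n) {a : ℚ} {k : ℤ} (h : 2 * a = k) :
    xpow i (-a) = sqrtX i ^ (-k) :=
  xpow_eq_zpow i (by push_cast; linear_combination -h)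

theorem soOdd_rect (n : ℕ) {R : ℕ} {s : ℚ} (hs : 2 * s + 1 = R) :
    soOdd n (rect n s) =
      oddAlternant R (sqrtX : Fin n → HalfField n) / oddAlternant 1 sqrtX := by
  rw [soOdd, oddAlternant, oddAlternant]
  congr 2
  · refine Matrix.ext fun i j => ?_
    simp only [Matrix.of_apply]
    rw [xpow_eq_zpow, xpow_neg_eq_zpow]
    all_goals
      simp only [rect, rho_eq_rev]
      push_cast
      linarith
  · refine Matrix.ext fun i j => ?_
    simp only [Matrix.of_apply]
    rw [xpow_eq_zpow, xpow_neg_eq_zpow]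
    all_goals
      simp only [rho_eq_rev]
      push_cast
      ring

/-- `sum_det_orthogonal_alternant` for the indeterminates `xᵢ`. -/
theorem sum_det_xpow (n a R : ℕ) (σ : HalfField n) {s : ℚ} (hs : 2 * s = 2 * a + (R - 1)) :
    ∑ lam ∈ decreasingSeqs n R, Matrix.det (Matrix.of fun i j : Fin n =>
        σ * xpow i (toSeq (fun k => lam k + a) j + rho j) +
          xpow i (-(toSeq (fun k => lam k + a) j + rho j))) =
      Matrix.det (Matrix.of fun i j : Fin n =>
        σ * xpow i (rect n s j + rho j) + xpow i (-(rect n s j + rho j))) *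
        (oddAlternant R (sqrtX : Fin n → HalfField n) / oddAlternant 1 sqrtX) := by
  have h := sum_det_orthogonal_alternant (fun u : ℤˣ => if u = 1 then σ else 1) a R
    (isRegularPoint_sqrtX n)
  have h1 : (-1 : ℤˣ) ≠ 1 := by decide
  simp only [if_true, if_neg h1, one_mul] at h
  convert h using 2
  · refine congrArg _ (Matrix.ext fun i j => ?_)
    simp only [Matrix.of_apply]
    rw [xpow_eq_zpow, xpow_neg_eq_zpow]
    all_goals
      simp only [toSeq, rho_eq_rev]
      push_cast
      ring
  · refine congrArg _ (Matrix.ext fun i j => ?_)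
    simp only [Matrix.of_apply]
    rw [xpow_eq_zpow, xpow_neg_eq_zpow]
    all_goals
      simp only [rect, rho_eq_rev]
      push_cast
      linarith

theorem seqLength_eq_iff {n : ℕ} (lam : Fin n → ℚ) : seqLength lam = n ↔ ∀ i, lam i ≠ 0 := by
  have h := Finset.card_filter_eq_iff (s := (Finset.univ : Finset (Fin n))) (p := fun i => lam i ≠ 0)
  rw [Finset.card_univ, Fintype.card_fin] at h
  rw [seqLength, h]
  simp

/-- Full length means that all parts are positive; subtracting 1 from each turns the condition into
the column shift a = 1. -/
theorem sum_boxPartitions_seqLength {M : Type*} [AddCommMonoid M] (n r : ℕ)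
    (f : (Fin n → ℕ) → M) :
    ∑ lam ∈ (boxPartitions n r).filter (fun lam => seqLength (toSeq lam) = n), f lam =
      ∑ lam ∈ decreasingSeqs n r, f (fun k => lam k + 1) := by
  symm
  refine Finset.sum_bij' (fun l _ => fun k => l k + 1) (fun l _ => fun k => l k - 1)
    ?_ ?_ ?_ ?_ ?_
  · intro l hl
    rw [mem_decreasingSeqs] at hl
    rw [Finset.mem_filter, seqLength_eq_iff]
    refine ⟨mem_decreasingSeqs.2 ⟨fun i => Nat.succ_lt_succ (hl.1 i),
      fun i j hij => Nat.succ_le_succ (hl.2 i j hij)⟩, fun i => ?_⟩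
    simp only [toSeq]
    exact_mod_cast Nat.succ_ne_zero (l i)
  · intro l hl
    rw [Finset.mem_filter, seqLength_eq_iff] at hl
    have h1 := mem_decreasingSeqs.1 hl.1
    refine mem_decreasingSeqs.2 ⟨fun i => ?_, fun i j hij => Nat.sub_le_sub_right (h1.2 i j hij) 1⟩
    have h2 : l i ≠ 0 := fun h => hl.2 i (by simp [toSeq, h])
    have := h1.1 i
    omega
  · intro l _
    rfl
  · intro l hl
    rw [Finset.mem_filter, seqLength_eq_iff] at hl
    funext i
    exact Nat.sub_add_cancel (Nat.pos_of_ne_zero fun h => hl.2 i (by simp [toSeq, h]))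
  · intro l _
    rfl

theorem theorem4p4 (n r : ℕ) (hr : 0 < r) :
    (∑ lam ∈ boxPartitions n r, soEven n (toSeq lam) =
      soEven n (rect n ((r : ℚ) / 2)) * soOdd n (rect n ((r : ℚ) / 2))) ∧
    (∑ lam ∈ (boxPartitions n r).filter (fun lam => seqLength (toSeq lam) = n),
        oEven n (toSeq lam) =
      oEven n (rect n (((r : ℚ) + 1) / 2)) * soOdd n (rect n (((r : ℚ) - 1) / 2))) := by
  constructor
  · rw [soOdd_rect n (R := r + 1) (by push_cast; ring)]
    simp only [soEven]
    rw [Finset.sum_comm, Finset.sum_mul]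
    refine Finset.sum_congr rfl fun σ _ => ?_
    rw [← Finset.sum_div, div_mul_eq_mul_div,
      ← sum_det_xpow n 0 (r + 1) (σ : HalfField n) (by push_cast; ring)]
    rfl
  · rw [soOdd_rect n (R := r) (by ring), sum_boxPartitions_seqLength]
    -- The factor u is 2 on both sides: (r+1)/2 is non-zero, as are all parts of the shifted
    -- sequences.
    have hrect : seqLength (rect n (((r : ℚ) + 1) / 2)) = n :=
      (seqLength_eq_iff _).2 fun _ => by simp only [rect]; positivity
    have hlen : ∀ lam : Fin n → ℕ, seqLength (toSeq fun k => lam k + 1) = n := fun lam =>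
      (seqLength_eq_iff _).2 fun i => by simp only [toSeq]; positivity
    have h := sum_det_xpow n 1 r (1 : HalfField n) (s := ((r : ℚ) + 1) / 2) (by push_cast; ring)
    simp only [one_mul] at h
    simp only [oEven, hrect, hlen, if_true]
    rw [← Finset.mul_sum, ← Finset.sum_div, h]
    ring
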